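/- **Theorem 2.** A sequence $\{m_n\}_{n\ge 0}$ of real numbers is called a Stieltjes moment sequence if there is a nonnegative measure $\mu$ on $[0,\infty)$ with $m_n=\int_{[0,\infty)}x^n\,d\mu(x)$ for all $n\ge 0$; it is called S-determinate if, in addition, this $\mu$ is unique; and it is called infinitely divisible if $\{m_n^c\}_{n\ge 0}$ is a Stieltjes moment sequence for every real $c>0$. Let $B_n=\binom{2n}{n}$, $n\ge 0$. Then: (a) $\{B_n\}_{n\ge 0}$ is an infinitely divisible Stieltjes moment sequence. (b) If $X$ is a real random variable with $E[X^n]=B_n$ for all $n\ge 0$, then $X$ has the density $f(x)=\dfrac{1}{\pi}\dfrac{1}{\sqrt{x(4-x)}}$ for $x\in(0,4)$ (and $0$ elsewhere), and for every $t\in\mathbb R$ its moment generating function is finite and $$M(t)=E[e^{tX}]=\sum_{n=0}^{\infty}B_n\frac{t^n}{n!}=e^{2t}I_0(2t),$$ where $I_\alpha(t)=\sum_{k=0}^{\infty}\dfrac{(t/2)^{2k+\alpha}}{k!\,\Gamma(k+\alpha+1)}$ is the modified Bessel function of the first kind. (c) For each real $c>0$, the sequence $\{B_n^c\}_{n\ge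 0}$ is S-determinate. (d) For each real $c>0$, the measure $\mu_c$ on $[0,\infty)$ with moment sequence $\{B_n^c\}_{n\ge 0}$ has the Mellin transform $$\int_0^\infty t^s\,d\mu_c(t)=\left(\frac{2^{2s}}{\sqrt{\pi}}\cdot\frac{\Gamma(s+1/2)}{\Gamma(s+1)}\right)^c=\left(\frac{\Gamma(2s+1)}{(\Gamma(s+1))^2}\right)^c,\qquad s\ge 0.$$ -/

import Mathlib

open MeasureTheory ProbabilityTheory

/-- `μ` is a nonnegative measure on `[0, ∞)` (a measure on `ℝ` that gives no mass to the negative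
half-line), all of whose moments exist, with `n`-th moment `m n` for every `n`. -/
def HasStieltjesMoments (μ : Measure ℝ) (m : ℕ → ℝ) : Prop :=
  μ (Set.Iio 0) = 0 ∧ ∀ n : ℕ, Integrable (fun x : ℝ => x ^ n) μ ∧ ∫ x, x ^ n ∂μ = m n

/-- A Stieltjes moment sequence: the moment sequence of some measure on `[0, ∞)`. -/
def IsStieltjesMomentSeq (m : ℕ → ℝ) : Prop :=
  ∃ μ : Measure ℝ, HasStieltjesMoments μ m

/-- An infinitely divisible Stieltjes moment sequence: every real power `m ^ c` with `c > 0`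
(hence, for `c = 1`, the sequence itself) is a Stieltjes moment sequence. -/
def IsInfDivStieltjesMomentSeq (m : ℕ → ℝ) : Prop :=
  ∀ c : ℝ, 0 < c → IsStieltjesMomentSeq (fun n => m n ^ c)

/-- A Stieltjes determinate (S-det) sequence: the moment sequence of exactly one measure on
`[0, ∞)`. -/
def IsStieltjesDet (m : ℕ → ℝ) : Prop :=
  ∃! μ : Measure ℝ, HasStieltjesMoments μ m

/-- The scaled arcsine density `1 / (π √(x (4 - x)))` on `(0, 4)`, zero elsewhere. -/
noncomputable def arcsineDensity : ℝ → ℝ :=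
  Set.indicator (Set.Ioo 0 4) (fun x => 1 / Real.pi * (1 / Real.sqrt (x * (4 - x))))

/-- The modified Bessel function of the first kind, of integer order `α ≥ 0`. -/
noncomputable def besselI (α : ℕ) (t : ℝ) : ℝ :=
  ∑' k : ℕ, (t / 2) ^ (2 * k + α) / ((k.factorial : ℝ) * Real.Gamma ((k : ℝ) + α + 1))

/-! Since B_n = 4^n Γ(n+1/2) / (√π Γ(n+1)), Euler's limit for Γ writes B_n / 4^n as the value at s =
n of ∏_k (k+1/2)(s+k+1) / ((s+k+1/2)(k+1)). Every c-th power of a factor is the Laplace transform of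
a law on [0, ∞), because a negative binomial series with nonnegative weights expresses it through
Gamma transforms (`exists_measure_laplace_rpow`). For independent Y_k with these laws, exp(-∑ Y_k)
therefore has the c-th power of the product as Mellin transform
(`exists_measure_mellin_of_tendsto_prod`), and scaling by 4^c gives μ_c.

The moments B_n^c ≤ (4^c)^n grow geometrically, so the complex moment generating function is the sum
of its moment series and determines the measure (`measure_eq_of_moment_eq`). Uniqueness then
transfers the Mellin formula to every solution and identifies the law of X with the arcsine law. -/

/-! ### Geometric moment growth and determinacy -/

/-- Moments of at most geometric growth make the series of absolute moments
`∑ ‖z‖ ^ n / n! * ∫ |x| ^ n` converge. -/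
theorem summable_integral_norm_of_moment_le {μ : Measure ℝ} {C : ℝ}
    (hint : ∀ n : ℕ, Integrable (fun x : ℝ => x ^ n) μ)
    (hC : ∀ n : ℕ, ∫ x, x ^ n ∂μ ≤ C ^ n) (z : ℂ) :
    Summable fun n : ℕ => ∫ x : ℝ, ‖(z * x) ^ n / (n.factorial : ℂ)‖ ∂μ := by
  have h1 : Summable fun n : ℕ => ‖z‖ ^ n / n.factorial + (‖z‖ * C ^ 2) ^ n / n.factorial :=
    (Real.summable_pow_div_factorial _).add (Real.summable_pow_div_factorial _)
  refine Summable.of_nonneg_of_le (fun n => integral_nonneg fun x => norm_nonneg _) (fun n => ?_) h1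
  have hn : (fun x : ℝ => ‖(z * x) ^ n / (n.factorial : ℂ)‖) =
      fun x : ℝ => ‖z‖ ^ n / n.factorial * |x ^ n| := by
    ext x
    simp [mul_pow]
    ring
  rw [hn, integral_const_mul]
  -- Only signed moments are bounded, so |x^n| ≤ 1 + x^(2n) passes to even exponents; no support
  -- condition is needed.
  have h2 : ∫ x : ℝ, |x ^ n| ∂μ ≤ 1 + C ^ (2 * n) := by
    calc ∫ x : ℝ, |x ^ n| ∂μ ≤ ∫ x : ℝ, (x ^ 0 + x ^ (2 * n)) ∂μ := by
          refine integral_mono (hint n).abs ((hint 0).add (hint (2 * n))) fun x => ?_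
          have h3 : x ^ (2 * n) = |x ^ n| ^ 2 := by rw [sq_abs]; ring
          simp only [pow_zero, h3]
          nlinarith [sq_nonneg (|x ^ n| - 1), abs_nonneg (x ^ n)]
      _ = ∫ x : ℝ, x ^ 0 ∂μ + ∫ x : ℝ, x ^ (2 * n) ∂μ := integral_add (hint 0) (hint _)
      _ ≤ _ := add_le_add (by simpa using hC 0) (hC _)
  calc ‖z‖ ^ n / n.factorial * ∫ x : ℝ, |x ^ n| ∂μ
      ≤ ‖z‖ ^ n / n.factorial * (1 + C ^ (2 * n)) := by gcongr
    _ = _ := by rw [mul_pow, ← pow_mul]; ring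

theorem integrable_pow_mul_div_factorial {μ : Measure ℝ}
    (hint : ∀ n : ℕ, Integrable (fun x : ℝ => x ^ n) μ) (z : ℂ) (n : ℕ) :
    Integrable (fun x : ℝ => (z * x) ^ n / (n.factorial : ℂ)) μ := by
  have h := ((hint n).ofReal (𝕜 := ℂ)).const_mul (z ^ n / n.factorial)
  refine h.congr (Filter.Eventually.of_forall fun x => ?_)
  simp [mul_pow]
  ring

/-- The exponential series of the moments sums to the complex moment generating function. -/
theorem hasSum_complexMGF_of_moment_le {μ : Measure ℝ} {C : ℝ}
    (hint : ∀ n : ℕ, Integrable (fun x : ℝ => x ^ n) μ)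
    (hC : ∀ n : ℕ, ∫ x, x ^ n ∂μ ≤ C ^ n) (z : ℂ) :
    HasSum (fun n : ℕ => z ^ n / n.factorial * ((∫ x, x ^ n ∂μ : ℝ) : ℂ)) (complexMGF id μ z) := by
  have h := hasSum_integral_of_summable_integral_norm
    (integrable_pow_mul_div_factorial hint z) (summable_integral_norm_of_moment_le hint hC z)
  have h1 : ∀ n : ℕ, ∫ x : ℝ, (z * x) ^ n / (n.factorial : ℂ) ∂μ =
      z ^ n / n.factorial * ((∫ x, x ^ n ∂μ : ℝ) : ℂ) := by
    intro n
    rw [← integral_complex_ofReal, ← integral_const_mul]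
    refine integral_congr_ae (Filter.Eventually.of_forall fun x => ?_)
    simp [mul_pow]
    ring
  have h2 : ∀ x : ℝ, ∑' n : ℕ, (z * x) ^ n / (n.factorial : ℂ) = Complex.exp (z * x) := fun x => by
    rw [Complex.exp_eq_exp_ℂ, NormedSpace.exp_eq_tsum_div]
  simp only [h1, h2] at h
  exact h

/-- An integral defaults to 0 without integrability, so the value of `mgf` does not show finiteness.
Here Tonelli bounds the exponential by its termwise absolute series. -/
theorem integrable_exp_mul_of_moment_le {μ : Measure ℝ} {C : ℝ}
    (hint : ∀ n : ℕ, Integrable (fun x : ℝ => x ^ n) μ)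
    (hC : ∀ n : ℕ, ∫ x, x ^ n ∂μ ≤ C ^ n) (t : ℝ) :
    Integrable (fun x => Real.exp (t * x)) μ := by
  have hs := summable_integral_norm_of_moment_le hint hC t
  refine ⟨by fun_prop, ?_⟩
  have hle : ∀ x : ℝ, ‖Real.exp (t * x)‖ₑ ≤
      ∑' n : ℕ, ‖((t : ℂ) * x) ^ n / (n.factorial : ℂ)‖ₑ := by
    intro x
    have h1 : Summable fun n : ℕ => ‖((t : ℂ) * x) ^ n / (n.factorial : ℂ)‖ :=
      NormedSpace.norm_expSeries_div_summable _
    have h2 : ‖Real.exp (t * x)‖ₑ = ‖∑' n : ℕ, ((t : ℂ) * x) ^ n / (n.factorial : ℂ)‖ₑ := by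
      rw [← congrFun (NormedSpace.exp_eq_tsum_div (𝔸 := ℂ)) _, ← Complex.exp_eq_exp_ℂ,
        ← Complex.ofReal_mul, ← Complex.ofReal_exp, ← ofReal_norm, ← ofReal_norm, Complex.norm_real]
    rw [h2]
    exact enorm_tsum_le_tsum_enorm
  refine lt_of_le_of_lt (lintegral_mono hle) ?_
  rw [lintegral_tsum fun n =>
    (integrable_pow_mul_div_factorial hint t n).aestronglyMeasurable.enorm]
  have h3 : ∀ n : ℕ, ∫⁻ x : ℝ, ‖((t : ℂ) * x) ^ n / (n.factorial : ℂ)‖ₑ ∂μ =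
      ENNReal.ofReal (∫ x : ℝ, ‖((t : ℂ) * x) ^ n / (n.factorial : ℂ)‖ ∂μ) := fun n =>
    (ofReal_integral_norm_eq_lintegral_enorm (integrable_pow_mul_div_factorial hint t n)).symm
  simp only [h3]
  rw [← ENNReal.ofReal_tsum_of_nonneg (fun n => integral_nonneg fun x => norm_nonneg _) hs]
  exact ENNReal.ofReal_lt_top

theorem hasSum_mgf_of_moment_le {μ : Measure ℝ} {C : ℝ}
    (hint : ∀ n : ℕ, Integrable (fun x : ℝ => x ^ n) μ)
    (hC : ∀ n : ℕ, ∫ x, x ^ n ∂μ ≤ C ^ n) (t : ℝ) :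
    HasSum (fun n : ℕ => t ^ n / n.factorial * ∫ x, x ^ n ∂μ) (mgf id μ t) := by
  have h := hasSum_complexMGF_of_moment_le hint hC t
  rw [complexMGF_ofReal] at h
  exact_mod_cast h

/-- A measure whose moments grow at most geometrically is determined by its moments. -/
theorem measure_eq_of_moment_eq {μ ν : Measure ℝ} {C : ℝ}
    (hμ : ∀ n : ℕ, Integrable (fun x : ℝ => x ^ n) μ)
    (hν : ∀ n : ℕ, Integrable (fun x : ℝ => x ^ n) ν)
    (hC : ∀ n : ℕ, ∫ x, x ^ n ∂μ ≤ C ^ n)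
    (h : ∀ n : ℕ, ∫ x, x ^ n ∂μ = ∫ x, x ^ n ∂ν) : μ = ν := by
  have finite_of_integrable (ρ : Measure ℝ) (hρ : Integrable (fun x : ℝ => x ^ 0) ρ) :
      IsFiniteMeasure ρ := by
    simpa [integrable_const_iff, isFiniteMeasure_iff] using hρ
  have := finite_of_integrable μ (hμ 0)
  have := finite_of_integrable ν (hν 0)
  refine Measure.ext_of_complexMGF_id_eq (funext fun z => ?_)
  refine (hasSum_complexMGF_of_moment_le hμ hC z).unique ?_
  simp only [h]
  exact hasSum_complexMGF_of_moment_le hν (fun n => h n ▸ hC n) z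

/-! ### Laplace transforms of the factors -/

/-- The Gamma law of integer shape `j` and rate `β` (a point mass at `0` if `j = 0`) has Laplace
transform `(β / (β + s)) ^ j`. -/
theorem exists_measure_laplace_pow {β : ℝ} (hβ : 0 < β) (j : ℕ) :
    ∃ ν : Measure ℝ, ν (Set.Iio 0) = 0 ∧ ∀ s : ℝ, 0 ≤ s →
      ∫⁻ x, ENNReal.ofReal (Real.exp (-s * x)) ∂ν = ENNReal.ofReal ((β / (β + s)) ^ j) := by
  rcases Nat.eq_zero_or_pos j with rfl | hj
  · refine ⟨Measure.dirac 0, by simp, fun s _ => ?_⟩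
    rw [lintegral_dirac' _ (by fun_prop)]
    simp
  have hj' : (0 : ℝ) < j := by exact_mod_cast hj
  refine ⟨gammaMeasure j β, ?_, fun s hs => ?_⟩
  · rw [gammaMeasure, withDensity_apply _ measurableSet_Iio]
    exact lintegral_gammaPDF_of_nonpos le_rfl
  have hmeas : Measurable (gammaPDF j β) := (measurable_gammaPDFReal _ _).ennreal_ofReal
  have hr : 0 < β + s := by linarith
  rw [gammaMeasure, lintegral_withDensity_eq_lintegral_mul _ hmeas (by fun_prop)]
  have hpt : (gammaPDF j β * fun x => ENNReal.ofReal (Real.exp (-s * x))) =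
      fun x => ENNReal.ofReal ((β / (β + s)) ^ j) * gammaPDF j (β + s) x := by
    ext x
    simp only [Pi.mul_apply]
    rcases lt_or_ge x 0 with hx | hx
    · simp [gammaPDF_of_neg hx]
    · rw [gammaPDF_of_nonneg hx, gammaPDF_of_nonneg hx, ← ENNReal.ofReal_mul (by positivity),
        ← ENNReal.ofReal_mul (by positivity)]
      congr 1
      have : Real.exp (-((β + s) * x)) = Real.exp (-(β * x)) * Real.exp (-s * x) := by
        rw [← Real.exp_add]; ring_nf
      rw [this, Real.rpow_natCast, Real.rpow_natCast, div_pow]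
      field_simp
  have hmeas' : Measurable (gammaPDF j (β + s)) := (measurable_gammaPDFReal _ _).ennreal_ofReal
  rw [hpt, lintegral_const_mul _ hmeas', lintegral_gammaPDF_eq_one hj' hr, mul_one]

/-- Times n!, this is the rising factorial c(c+1)⋯(c+n-1), which is positive for every real c > 0.
-/
theorem choose_add_sub_one_nonneg {c : ℝ} (hc : 0 < c) (n : ℕ) :
    0 ≤ Ring.choose (c + n - 1) n := by
  have h : (n.factorial : ℝ) * Ring.choose (c + n - 1) n = (ascPochhammer ℝ n).eval c := by
    rw [← Polynomial.ascPochhammer_smeval_eq_eval, ← Ring.factorial_nsmul_multichoose_eq_ascPochhammer,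
      nsmul_eq_mul, Ring.choose]
    ring_nf
  have h1 := ascPochhammer_pos n c hc
  rw [← h] at h1
  exact (pos_of_mul_pos_right h1 (by positivity)).le

theorem hasSum_choose_mul_pow {c x : ℝ} (hx0 : 0 ≤ x) (hx : x < 1) :
    HasSum (fun n : ℕ => Ring.choose (c + n - 1) n * x ^ n) (1 / (1 - x) ^ c) := by
  have h := (Real.one_div_one_sub_rpow_hasFPowerSeriesOnBall_zero c).hasSum (y := x)
    (by simpa [enorm_eq_nnnorm, ← NNReal.coe_lt_coe, abs_of_nonneg hx0] using hx)
  simpa [FormalMultilinearSeries.ofScalars_apply_eq, mul_comm] using h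

/-- The law on `[0, ∞)` with Laplace transform `(a (s + a + b) / ((s + a) (a + b))) ^ c`, a negative
binomial mixture of Gamma laws. -/
theorem exists_measure_laplace_rpow {a b c : ℝ} (ha : 0 < a) (hb : 0 < b) (hc : 0 < c) :
    ∃ ν : Measure ℝ, ν (Set.Iio 0) = 0 ∧ ∀ s : ℝ, 0 ≤ s →
      ∫⁻ x, ENNReal.ofReal (Real.exp (-s * x)) ∂ν =
        ENNReal.ofReal ((a * (s + a + b) / ((s + a) * (a + b))) ^ c) := by
  have hβ : 0 < a + b := by linarith
  choose ν hν0 hν using exists_measure_laplace_pow hβ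
  -- With β = a + b, the target is (a/β)^c (1 - b/(β+s))^(-c), and b/(β+s) = (b/β) · β/(β+s); the
  -- weights are the coefficients of (β/(β+s))^j.
  let w : ℕ → ℝ := fun j => (a / (a + b)) ^ c * (Ring.choose (c + j - 1) j * (b / (a + b)) ^ j)
  have hw : ∀ j, 0 ≤ w j := fun j => by
    have := choose_add_sub_one_nonneg hc j
    positivity
  refine ⟨Measure.sum fun j => ENNReal.ofReal (w j) • ν j, ?_, fun s hs => ?_⟩
  · rw [Measure.sum_apply _ measurableSet_Iio]
    simp [hν0]
  rw [lintegral_sum_measure]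
  simp only [lintegral_smul_measure, hν _ s hs, smul_eq_mul]
  have hsum : HasSum (fun j => w j * ((a + b) / (a + b + s)) ^ j)
      ((a / (a + b)) ^ c * (1 / (1 - b / (a + b + s)) ^ c)) := by
    have h := (hasSum_choose_mul_pow (c := c) (x := b / (a + b + s)) (by positivity)
      (by rw [div_lt_one (by positivity)]; linarith)).mul_left ((a / (a + b)) ^ c)
    have heq : (fun j : ℕ => w j * ((a + b) / (a + b + s)) ^ j) = fun j : ℕ =>
        (a / (a + b)) ^ c * (Ring.choose (c + j - 1) j * (b / (a + b + s)) ^ j) := by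
      ext j
      simp only [w, div_pow]
      field_simp
    rwa [heq]
  have hnn : ∀ j, 0 ≤ w j * ((a + b) / (a + b + s)) ^ j := fun j =>
    mul_nonneg (hw j) (by positivity)
  simp only [← ENNReal.ofReal_mul (hw _)]
  rw [← ENNReal.ofReal_tsum_of_nonneg hnn hsum.summable, hsum.tsum_eq]
  congr 1
  have h1 : 1 - b / (a + b + s) = (s + a) / (a + b + s) := by field_simp; ring
  rw [h1, one_div, ← Real.inv_rpow (by positivity), ← Real.mul_rpow (by positivity) (by positivity)]
  congr 1
  field_simp
  ring

/-! ### Infinite products of independent factors -/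

/-- An infinite product of independent variables `exp (-Y k)`, `Y k ≥ 0`: if the partial products
of the Laplace transforms converge, the limit is a Mellin transform of a law on `[0, 1]`. -/
theorem exists_measure_mellin_of_tendsto_prod {ρ : ℕ → Measure ℝ} {φ : ℕ → ℝ → ℝ} {Φ : ℝ → ℝ}
    (hρ : ∀ k, ρ k (Set.Iio 0) = 0) (hφ0 : ∀ k, φ k 0 = 1)
    (hφ : ∀ k s, 0 ≤ s → 0 ≤ φ k s)
    (hlap : ∀ k s, 0 ≤ s →
      ∫⁻ x, ENNReal.ofReal (Real.exp (-s * x)) ∂ρ k = ENNReal.ofReal (φ k s))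
    (hlim : ∀ s, 0 ≤ s → Filter.Tendsto (fun n => ∏ k ∈ Finset.range n, φ k s) Filter.atTop
      (nhds (Φ s))) :
    ∃ μ : Measure ℝ, IsProbabilityMeasure μ ∧ (∀ᵐ x ∂μ, x ∈ Set.Icc 0 1) ∧
      ∀ s : ℝ, 0 ≤ s → ∫ x, x ^ s ∂μ = Φ s := by
  have hprob : ∀ k, IsProbabilityMeasure (ρ k) := fun k => ⟨by
    have h := hlap k 0 le_rfl
    simpa [hφ0] using h⟩
  let P := Measure.infinitePi ρ
  have hnonneg : ∀ᵐ ω ∂P, ∀ k, 0 ≤ ω k := by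
    rw [ae_all_iff]
    intro k
    have h : ∀ᵐ x ∂(ρ k), 0 ≤ x := by
      rw [ae_iff]
      simpa [Set.Iio] using hρ k
    exact (measurePreserving_eval_infinitePi ρ k).quasiMeasurePreserving.ae h
  have hind : iIndepFun (fun (k : ℕ) (ω : ℕ → ℝ) => ω k) P :=
    iIndepFun_infinitePi (X := fun _ x => x) fun _ => measurable_id
  have hmgf : ∀ s, 0 ≤ s → ∀ n, ∫ ω, Real.exp (-s * ∑ k ∈ Finset.range n, ω k) ∂P =
      ∏ k ∈ Finset.range n, φ k s := by
    intro s hs n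
    have h := hind.mgf_sum (t := -s) (fun k => measurable_pi_apply k) (Finset.range n)
    simp only [mgf, Finset.sum_apply] at h
    rw [h]
    refine Finset.prod_congr rfl fun k _ => ?_
    have hmap := integral_map (μ := P) (measurable_pi_apply k).aemeasurable
      (f := fun x : ℝ => Real.exp (-s * x)) (by fun_prop)
    rw [(measurePreserving_eval_infinitePi ρ k).map_eq] at hmap
    rw [← hmap, integral_eq_lintegral_of_nonneg_ae (Filter.Eventually.of_forall fun x => (Real.exp_pos _).le)
      (by fun_prop), hlap k s hs, ENNReal.toReal_ofReal (hφ k s hs)]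
  let E : ℕ → (ℕ → ℝ) → ℝ := fun n ω => Real.exp (-∑ k ∈ Finset.range n, ω k)
  have hEm : ∀ n, Measurable (E n) := fun n => by fun_prop
  -- The partial products decrease almost surely, so the infimum is their limit; ∑ ω k may diverge,
  -- and then X = 0.
  let X : (ℕ → ℝ) → ℝ := fun ω => ⨅ n, E n ω
  have hXm : Measurable X := Measurable.iInf hEm
  have hEmem : ∀ n, ∀ᵐ ω ∂P, E n ω ∈ Set.Icc (0 : ℝ) 1 := fun n => by
    filter_upwards [hnonneg] with ω hω
    exact ⟨(Real.exp_pos _).le, Real.exp_le_one_iff.2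
      (neg_nonpos.2 (Finset.sum_nonneg fun k _ => hω k))⟩
  have hXlim : ∀ᵐ ω ∂P, Filter.Tendsto (fun n => E n ω) Filter.atTop (nhds (X ω)) := by
    filter_upwards [hnonneg] with ω hω
    refine tendsto_atTop_ciInf (antitone_nat_of_succ_le fun n => ?_) ⟨0, ?_⟩
    · refine Real.exp_le_exp.2 (neg_le_neg ?_)
      rw [Finset.sum_range_succ]
      linarith [hω n]
    · rintro _ ⟨n, rfl⟩
      exact (Real.exp_pos _).le
  have hXmem : ∀ᵐ ω ∂P, X ω ∈ Set.Icc (0 : ℝ) 1 := by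
    filter_upwards [hXlim, ae_all_iff.2 hEmem] with ω h1 h2
    exact isClosed_Icc.mem_of_tendsto h1 (Filter.Eventually.of_forall h2)
  refine ⟨P.map X, Measure.isProbabilityMeasure_map hXm.aemeasurable, ?_, fun s hs => ?_⟩
  · exact (ae_map_iff hXm.aemeasurable measurableSet_Icc).2 hXmem
  rw [integral_map hXm.aemeasurable (by fun_prop)]
  refine tendsto_nhds_unique ?_ (hlim s hs)
  have hEs : ∀ n ω, E n ω ^ s = Real.exp (-s * ∑ k ∈ Finset.range n, ω k) := fun n ω => by
    rw [← Real.exp_mul]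
    ring_nf
  simp only [← hmgf s hs, ← hEs]
  refine tendsto_integral_of_dominated_convergence (fun _ => 1)
    (fun n => ((hEm n).pow_const s).aestronglyMeasurable) (integrable_const _) (fun n => ?_) ?_
  · filter_upwards [hEmem n] with ω h
    rw [Real.norm_eq_abs, abs_of_nonneg (Real.rpow_nonneg h.1 s)]
    exact Real.rpow_le_one h.1 h.2 hs
  · filter_upwards [hXlim] with ω h
    exact h.rpow_const (Or.inr hs)

/-! ### Gamma ratios and central binomial coefficients -/

/-- Euler's product for `Γ (1) Γ (s + 1/2) / (Γ (1/2) Γ (s + 1))`. -/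
theorem tendsto_prod_gamma_ratio {s : ℝ} (hs : 0 ≤ s) :
    Filter.Tendsto (fun n : ℕ => ∏ k ∈ Finset.range n,
      (((k : ℝ) + 1 / 2) * (s + (k + 1 / 2) + 1 / 2) / ((s + (k + 1 / 2)) * (k + 1 / 2 + 1 / 2))))
      Filter.atTop (nhds (Real.Gamma (s + 1 / 2) / Real.Gamma (s + 1) / Real.sqrt Real.pi)) := by
  -- `Real.GammaSeq` at n has n + 1 factors in its denominator.
  rw [← Filter.tendsto_add_atTop_iff_nat 1]
  have h := ((Real.GammaSeq_tendsto_Gamma (s + 1 / 2)).div (Real.GammaSeq_tendsto_Gamma (s + 1))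
    (Real.Gamma_pos_of_pos (by positivity)).ne').mul
    ((Real.GammaSeq_tendsto_Gamma 1).div (Real.GammaSeq_tendsto_Gamma (1 / 2))
    (Real.Gamma_pos_of_pos (by positivity)).ne')
  rw [Real.Gamma_one, Real.Gamma_one_half_eq, mul_one_div] at h
  refine h.congr' ?_
  filter_upwards [Filter.eventually_gt_atTop 0] with n hn
  have hn' : (0 : ℝ) < n := by exact_mod_cast hn
  simp only [Real.GammaSeq, Pi.div_apply]
  have hp : ∀ t : ℝ, 0 < t → 0 < ∏ j ∈ Finset.range (n + 1), (t + j) := fun t ht =>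
    Finset.prod_pos fun j _ => by positivity
  have h1 := hp (s + 1 / 2) (by positivity)
  have h2 := hp (s + 1) (by positivity)
  have h3 := hp 1 (by positivity)
  have h4 := hp (1 / 2) (by positivity)
  have hprod : ∏ k ∈ Finset.range (n + 1),
      (((k : ℝ) + 1 / 2) * (s + (k + 1 / 2) + 1 / 2) / ((s + (k + 1 / 2)) * (k + 1 / 2 + 1 / 2))) =
      (∏ j ∈ Finset.range (n + 1), ((1 / 2 : ℝ) + j)) * (∏ j ∈ Finset.range (n + 1), (s + 1 + j)) /
      ((∏ j ∈ Finset.range (n + 1), (s + 1 / 2 + j)) * ∏ j ∈ Finset.range (n + 1), ((1 : ℝ) + j)) := by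
    rw [← Finset.prod_mul_distrib, ← Finset.prod_mul_distrib, ← Finset.prod_div_distrib]
    refine Finset.prod_congr rfl fun k _ => ?_
    congr 1 <;> ring
  have hpow : (n : ℝ) ^ (s + 1 / 2) * (n : ℝ) ^ (1 : ℝ) =
      (n : ℝ) ^ (s + 1) * (n : ℝ) ^ (1 / 2 : ℝ) := by
    rw [← Real.rpow_add hn', ← Real.rpow_add hn']
    ring_nf
  rw [hprod, eq_div_iff (by positivity)]
  have p1 := Real.rpow_pos_of_pos hn' (s + 1)
  have p2 := Real.rpow_pos_of_pos hn' (1 / 2 : ℝ)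
  have p3 : (0 : ℝ) < n.factorial := by positivity
  generalize ∏ j ∈ Finset.range (n + 1), (s + 1 / 2 + (j : ℝ)) = q1 at *
  generalize ∏ j ∈ Finset.range (n + 1), (s + 1 + (j : ℝ)) = q2 at *
  generalize ∏ j ∈ Finset.range (n + 1), ((1 : ℝ) + (j : ℝ)) = q3 at *
  generalize ∏ j ∈ Finset.range (n + 1), ((1 / 2 : ℝ) + (j : ℝ)) = q4 at *
  generalize (n : ℝ) ^ (s + 1 / 2) = r1 at *
  generalize (n : ℝ) ^ (s + 1) = r2 at *
  generalize (n : ℝ) ^ (1 : ℝ) = r3 at *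
  generalize (n : ℝ) ^ (1 / 2 : ℝ) = r4 at *
  field_simp
  exact hpow

/-- Legendre's duplication formula at s + 1/2. -/
theorem gamma_ratio_eq {s : ℝ} (hs : 0 ≤ s) :
    (2 : ℝ) ^ (2 * s) / Real.sqrt Real.pi * (Real.Gamma (s + 1 / 2) / Real.Gamma (s + 1)) =
      Real.Gamma (2 * s + 1) / Real.Gamma (s + 1) ^ 2 := by
  have h := Real.Gamma_mul_Gamma_add_half (s + 1 / 2)
  have h1 : s + 1 / 2 + 1 / 2 = s + 1 := by ring
  have h2 : 2 * (s + 1 / 2) = 2 * s + 1 := by ring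
  have h3 : 1 - (2 * s + 1) = -(2 * s) := by ring
  rw [h1, h2, h3, Real.rpow_neg two_pos.le] at h
  have hG := Real.Gamma_pos_of_pos (show 0 < s + 1 by linarith)
  have hp := Real.rpow_pos_of_pos two_pos (2 * s)
  have hpi := Real.sqrt_pos.2 Real.pi_pos
  field_simp at h ⊢
  linear_combination h

theorem centralBinom_eq_gamma_ratio (n : ℕ) :
    (Nat.centralBinom n : ℝ) = (2 : ℝ) ^ (2 * (n : ℝ)) / Real.sqrt Real.pi *
      (Real.Gamma (n + 1 / 2) / Real.Gamma (n + 1)) := by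
  rw [gamma_ratio_eq n.cast_nonneg, Nat.centralBinom_eq_two_mul_choose,
    Nat.cast_choose ℝ (by omega), Real.Gamma_nat_eq_factorial]
  have h : (2 * (n : ℝ) + 1) = ((2 * n : ℕ) : ℝ) + 1 := by push_cast; ring
  rw [h, Real.Gamma_nat_eq_factorial, show 2 * n - n = n by omega]
  ring

theorem centralBinom_le_four_pow (n : ℕ) : (Nat.centralBinom n : ℝ) ≤ 4 ^ n := by
  have h := Nat.choose_le_two_pow (2 * n) n
  rw [pow_mul] at h
  rw [Nat.centralBinom_eq_two_mul_choose]
  exact_mod_cast h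

theorem centralBinom_rpow_le {c : ℝ} (hc : 0 < c) (n : ℕ) :
    (Nat.centralBinom n : ℝ) ^ c ≤ ((4 : ℝ) ^ c) ^ n := by
  calc (Nat.centralBinom n : ℝ) ^ c ≤ ((4 : ℝ) ^ n) ^ c :=
        Real.rpow_le_rpow (Nat.cast_nonneg _) (centralBinom_le_four_pow n) hc.le
    _ = _ := (Real.rpow_pow_comm (by norm_num) c n).symm

/-! ### Construction of the measures -/

/-- The `c`-th power of the Mellin transform of the arcsine law is again a Mellin transform. -/
theorem exists_measure_mellin_gamma_ratio {c : ℝ} (hc : 0 < c) :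
    ∃ μ : Measure ℝ, μ (Set.Iio 0) = 0 ∧ ∀ s : ℝ, 0 ≤ s → Integrable (fun x : ℝ => x ^ s) μ ∧
      ∫ x, x ^ s ∂μ = ((2 : ℝ) ^ (2 * s) / Real.sqrt Real.pi *
        (Real.Gamma (s + 1 / 2) / Real.Gamma (s + 1))) ^ c := by
  choose ρ hρ0 hρ using fun k : ℕ =>
    exists_measure_laplace_rpow (show (0 : ℝ) < (k : ℝ) + 1 / 2 by positivity) one_half_pos hc
  have hnn : ∀ (k : ℕ) (s : ℝ), 0 ≤ s → 0 ≤ ((k : ℝ) + 1 / 2) * (s + (k + 1 / 2) + 1 / 2) /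
      ((s + (k + 1 / 2)) * (k + 1 / 2 + 1 / 2)) := fun k s hs => by positivity
  have hone : ∀ k : ℕ, (((k : ℝ) + 1 / 2) * (0 + (k + 1 / 2) + 1 / 2) /
      ((0 + (k + 1 / 2)) * (k + 1 / 2 + 1 / 2))) ^ c = 1 := fun k => by
    rw [zero_add, div_self (by positivity), Real.one_rpow]
  have hlim : ∀ s : ℝ, 0 ≤ s → Filter.Tendsto (fun n : ℕ => ∏ k ∈ Finset.range n,
      (((k : ℝ) + 1 / 2) * (s + (k + 1 / 2) + 1 / 2) /
        ((s + (k + 1 / 2)) * (k + 1 / 2 + 1 / 2))) ^ c) Filter.atTop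
      (nhds ((Real.Gamma (s + 1 / 2) / Real.Gamma (s + 1) / Real.sqrt Real.pi) ^ c)) :=
    fun s hs => ((tendsto_prod_gamma_ratio hs).rpow_const (Or.inr hc.le)).congr fun n =>
      (Real.finsetProd_rpow _ _ (fun k _ => hnn k s hs) c).symm
  obtain ⟨μ, hμ, hμmem, hmom⟩ := exists_measure_mellin_of_tendsto_prod hρ0 hone
    (fun k s hs => Real.rpow_nonneg (hnn k s hs) c) hρ hlim
  have h4 : (0 : ℝ) < 4 ^ c := by positivity
  have hm : Measurable fun x : ℝ => (4 : ℝ) ^ c * x := by fun_prop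
  -- The scaling supplies the missing factor (4^c)^s = (2^(2s))^c.
  refine ⟨μ.map fun x => 4 ^ c * x, ?_, fun s hs => ?_⟩
  · rw [Measure.map_apply hm measurableSet_Iio]
    refine measure_eq_zero_iff_ae_notMem.2 ?_
    filter_upwards [hμmem] with x hx
    exact not_lt.2 (mul_nonneg h4.le hx.1)
  · have hsplit : ∀ᵐ x ∂μ, (4 ^ c * x) ^ s = (4 ^ c) ^ s * x ^ s := by
      filter_upwards [hμmem] with x hx
      exact Real.mul_rpow h4.le hx.1
    have hint : Integrable (fun x : ℝ => x ^ s) μ := by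
      refine Integrable.of_bound (by fun_prop) 1 ?_
      filter_upwards [hμmem] with x hx
      rw [Real.norm_eq_abs, abs_of_nonneg (Real.rpow_nonneg hx.1 s)]
      exact Real.rpow_le_one hx.1 hx.2 hs
    constructor
    · rw [integrable_map_measure (by fun_prop) hm.aemeasurable]
      exact (hint.const_mul _).congr (hsplit.mono fun x hx => hx.symm)
    · rw [integral_map hm.aemeasurable (by fun_prop), integral_congr_ae hsplit,
        integral_const_mul, hmom s hs]
      have hG := Real.Gamma_pos_of_pos (show 0 < s + 1 by linarith)
      have hG' := Real.Gamma_pos_of_pos (show 0 < s + 1 / 2 by linarith)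
      rw [← Real.rpow_mul (by norm_num), mul_comm c s, Real.rpow_mul (by norm_num),
        ← Real.mul_rpow (by positivity) (by positivity), Real.rpow_mul two_pos.le]
      norm_num
      ring_nf

/-! ### The arcsine law -/

/-- The moments now follow from the normalization of the Beta laws; the division by 4 cancels the
Jacobian of x = 4u. -/
theorem pow_mul_arcsineDensity (n : ℕ) (x : ℝ) :
    x ^ n * arcsineDensity x =
      Nat.centralBinom n / 4 * betaPDFReal (n + 1 / 2) (1 / 2) (x / 4) := by
  by_cases hx : x ∈ Set.Ioo (0 : ℝ) 4
  · have h0 : 0 < x / 4 := by linarith [hx.1]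
    have h1 : 0 < 1 - x / 4 := by linarith [hx.2]
    rw [arcsineDensity, Set.indicator_of_mem hx, betaPDFReal, if_pos ⟨h0, by linarith⟩,
      centralBinom_eq_gamma_ratio, beta, Real.Gamma_one_half_eq]
    obtain ⟨u, rfl⟩ : ∃ u, x = 4 * u := ⟨x / 4, by ring⟩
    have hu : 4 * u / 4 = u := by ring
    rw [hu] at h0 h1 ⊢
    have e1 : (n : ℝ) + 1 / 2 + 1 / 2 = n + 1 := by ring
    have e2 : (n : ℝ) + 1 / 2 - 1 = n + -(1 / 2) := by ring
    have e3 : (1 : ℝ) / 2 - 1 = -(1 / 2) := by norm_num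
    have e4 : 4 * u * (4 - 4 * u) = 4 ^ 2 * (u * (1 - u)) := by ring
    have e5 : (2 : ℝ) ^ (2 * (n : ℝ)) = 4 ^ n := by
      rw [Real.rpow_mul two_pos.le, Real.rpow_natCast]; norm_num
    rw [e1, e2, e3, e4, e5, Real.rpow_add h0, Real.rpow_natCast, Real.rpow_neg h0.le,
      Real.rpow_neg h1.le, ← Real.sqrt_eq_rpow, ← Real.sqrt_eq_rpow, Real.sqrt_mul (by positivity),
      Real.sqrt_sq (by norm_num), Real.sqrt_mul h0.le, mul_pow]
    have hG := Real.Gamma_pos_of_pos (show (0 : ℝ) < n + 1 by positivity)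
    have hG' := Real.Gamma_pos_of_pos (show (0 : ℝ) < n + 1 / 2 by positivity)
    have hpi := Real.sqrt_pos.2 Real.pi_pos
    have hsq : Real.sqrt Real.pi ^ 2 = Real.pi := Real.sq_sqrt Real.pi_pos.le
    have hpi' := Real.pi_pos
    have s1 := Real.sqrt_pos.2 h0
    have s2 := Real.sqrt_pos.2 h1
    generalize Real.Gamma ((n : ℝ) + 1 / 2) = g at *
    field_simp
    rw [hsq]
  · have h : ¬ (0 < x / 4 ∧ x / 4 < 1) := fun h => hx ⟨by linarith [h.1], by linarith [h.2]⟩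
    rw [arcsineDensity, Set.indicator_of_notMem hx, betaPDFReal, if_neg h]
    ring

theorem integrable_and_integral_betaPDFReal {α β : ℝ} (hα : 0 < α) (hβ : 0 < β) :
    Integrable (betaPDFReal α β) ∧ ∫ x, betaPDFReal α β x = 1 := by
  have h0 : ∀ x, 0 ≤ betaPDFReal α β x := fun x => by
    by_cases hx : 0 < x ∧ x < 1
    · exact (betaPDFReal_pos hx.1 hx.2 hα hβ).le
    · rw [betaPDFReal, if_neg hx]
  have h1 : ∫⁻ x, ENNReal.ofReal (betaPDFReal α β x) = 1 := lintegral_betaPDF_eq_one hα hβ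
  have hm := (stronglyMeasurable_betaPDFReal α β).aestronglyMeasurable (μ := volume)
  constructor
  · refine ⟨hm, (hasFiniteIntegral_iff_ofReal (Filter.Eventually.of_forall h0)).2 ?_⟩
    rw [h1]
    exact ENNReal.one_lt_top
  · rw [integral_eq_lintegral_of_nonneg_ae (Filter.Eventually.of_forall h0) hm, h1]
    simp

theorem measurable_arcsineDensity : Measurable arcsineDensity :=
  Measurable.indicator (by fun_prop) measurableSet_Ioo

theorem arcsineDensity_nonneg (x : ℝ) : 0 ≤ arcsineDensity x :=
  Set.indicator_nonneg (fun _ _ => by positivity) x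

/-- The moments of the arcsine law on `(0, 4)` are the central binomial coefficients. -/
theorem arcsine_moments (n : ℕ) :
    Integrable (fun x : ℝ => x ^ n)
      (volume.withDensity fun x => ENNReal.ofReal (arcsineDensity x)) ∧
    ∫ x, x ^ n ∂(volume.withDensity fun x => ENNReal.ofReal (arcsineDensity x)) =
      Nat.centralBinom n := by
  obtain ⟨hi, h1⟩ := integrable_and_integral_betaPDFReal
    (show (0 : ℝ) < n + 1 / 2 by positivity) one_half_pos
  have hm : Measurable fun x => ENNReal.ofReal (arcsineDensity x) :=
    measurable_arcsineDensity.ennreal_ofReal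
  have hpt : (fun x : ℝ => (ENNReal.ofReal (arcsineDensity x)).toReal • x ^ n) = fun x =>
      Nat.centralBinom n / 4 * betaPDFReal (n + 1 / 2) (1 / 2) (x / 4) := by
    ext x
    rw [ENNReal.toReal_ofReal (arcsineDensity_nonneg x), smul_eq_mul, mul_comm,
      pow_mul_arcsineDensity]
  constructor
  · rw [integrable_withDensity_iff_integrable_smul' hm (by simp), hpt]
    exact (hi.comp_div (by norm_num)).const_mul _
  · rw [integral_withDensity_eq_integral_toReal_smul hm (by simp), hpt, integral_const_mul,
      Measure.integral_comp_div, h1]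
    norm_num

/-! ### The exponential generating function -/

open Polynomial in
/-- Compare coefficients of `X ^ n` in `((1 + X) ^ 2) ^ n = (2 X + (1 + X ^ 2)) ^ n`. -/
theorem centralBinom_eq_sum_antidiagonal (n : ℕ) :
    Nat.centralBinom n = ∑ p ∈ Finset.HasAntidiagonal.antidiagonal n,
      n.choose p.1 * 2 ^ p.1 * (if 2 ∣ p.2 then p.2.choose (p.2 / 2) else 0) := by
  have h : ((1 + X : ℕ[X]) ^ (2 * n)).coeff n =
      ((X * C 2 + expand ℕ 2 (1 + X)) ^ n).coeff n := by
    rw [pow_mul]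
    congr 2
    simp only [map_add, map_one, expand_X, map_ofNat]
    ring
  rw [coeff_one_add_X_pow, ← Nat.centralBinom_eq_two_mul_choose] at h
  rw [← Nat.cast_id (Nat.centralBinom n), h, (Commute.all _ _).add_pow', finsetSum_coeff]
  -- Choosing 2X from p.1 factors leaves the coefficient of X^p.2 in (1 + X²)^p.2: a middle binomial
  -- coefficient, or 0 for odd p.2.
  refine Finset.sum_congr rfl fun p hp => ?_
  have hp' : n = p.2 + p.1 := by rw [← Finset.HasAntidiagonal.mem_antidiagonal.1 hp, add_comm]
  rw [coeff_smul, mul_pow, ← C_pow, ← map_pow, mul_assoc, mul_comm (X ^ p.1)]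
  nth_rw 2 [hp']
  rw [coeff_mul_X_pow, coeff_C_mul, coeff_expand two_pos, smul_eq_mul]
  split_ifs with hd
  · rw [coeff_one_add_X_pow]
    simp [mul_assoc]
  · simp

/-- The exponential generating function of the central binomial coefficients. -/
theorem hasSum_centralBinom_mul_pow_div_factorial (t : ℝ) :
    HasSum (fun n : ℕ => (Nat.centralBinom n : ℝ) * (t ^ n / (n.factorial : ℝ)))
      (Real.exp (2 * t) * besselI 0 (2 * t)) := by
  -- I_0(2t) = ∑ t^(2k)/(k!)² = ∑ C(2k,k) t^(2k)/(2k)!, padded with zeros at odd indices to allow a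
  -- Cauchy product with exp(2t).
  let g : ℕ → ℝ := fun n =>
    if 2 ∣ n then (n.choose (n / 2) : ℝ) * (t ^ n / n.factorial) else 0
  have hbessel : besselI 0 (2 * t) = ∑' n, g n := by
    have hinj : Function.Injective fun k : ℕ => 2 * k := fun a b h => by
      simpa using h
    have hsupp : Function.support g ⊆ Set.range fun k : ℕ => 2 * k := fun n hn => by
      by_contra hr
      refine hn (if_neg fun ⟨k, hk⟩ => hr ⟨k, hk.symm⟩)
    rw [← hinj.tsum_eq hsupp, besselI]
    refine tsum_congr fun k => ?_
    simp only [g, dvd_mul_right, if_true, Nat.mul_div_cancel_left k two_pos]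
    rw [Nat.cast_choose ℝ (by omega), show 2 * k - k = k by omega, Nat.cast_zero, add_zero,
      add_zero, Real.Gamma_nat_eq_factorial, mul_div_cancel_left₀ t two_ne_zero]
    field_simp
  have hg : Summable fun n => ‖g n‖ := by
    refine Summable.of_nonneg_of_le (fun n => norm_nonneg _) (fun n => ?_)
      (Real.summable_pow_div_factorial (2 * |t|))
    simp only [g]
    split_ifs
    · have hc : (n.choose (n / 2) : ℝ) ≤ 2 ^ n := by exact_mod_cast Nat.choose_le_two_pow n (n / 2)
      rw [norm_mul, norm_div, norm_pow, Real.norm_eq_abs t, mul_pow, mul_div_assoc]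
      simp only [RCLike.norm_natCast]
      gcongr
    · simp only [norm_zero]
      positivity
  have hf : Summable fun n : ℕ => ‖(2 * t) ^ n / (n.factorial : ℝ)‖ :=
    NormedSpace.norm_expSeries_div_summable _
  have hs := (summable_norm_sum_mul_antidiagonal_of_summable_norm hf hg).of_norm.hasSum
  rw [← tsum_mul_tsum_eq_tsum_sum_antidiagonal_of_summable_norm hf hg, ← hbessel,
    ← congrFun (NormedSpace.exp_eq_tsum_div (𝔸 := ℝ)) _, ← Real.exp_eq_exp_ℝ] at hs
  refine hs.congr_fun fun n => ?_
  rw [centralBinom_eq_sum_antidiagonal, Nat.cast_sum, Finset.sum_mul]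
  refine Finset.sum_congr rfl fun p hp => ?_
  have hp' := Finset.HasAntidiagonal.mem_antidiagonal.1 hp
  simp only [g]
  split_ifs
  · have hpow : t ^ n = t ^ p.1 * t ^ p.2 := by rw [← pow_add, hp']
    have hch : (n.choose p.1 : ℝ) = n.factorial / (p.1.factorial * p.2.factorial) := by
      rw [Nat.cast_choose ℝ (by omega), show n - p.1 = p.2 by omega]
    push_cast
    rw [hpow, hch, mul_pow]
    field_simp
  · simp

/-! ### Existence, uniqueness and the theorem -/

theorem exists_hasStieltjesMoments_mellin {c : ℝ} (hc : 0 < c) :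
    ∃ μ : Measure ℝ, HasStieltjesMoments μ (fun n => (Nat.centralBinom n : ℝ) ^ c) ∧
      ∀ s : ℝ, 0 ≤ s → Integrable (fun x : ℝ => x ^ s) μ ∧
        ∫ x, x ^ s ∂μ = ((2 : ℝ) ^ (2 * s) / Real.sqrt Real.pi *
          (Real.Gamma (s + 1 / 2) / Real.Gamma (s + 1))) ^ c := by
  obtain ⟨μ, hμ, h⟩ := exists_measure_mellin_gamma_ratio hc
  refine ⟨μ, ⟨hμ, fun n => ?_⟩, h⟩
  have hn := h n n.cast_nonneg
  simp only [Real.rpow_natCast] at hn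
  rwa [← centralBinom_eq_gamma_ratio] at hn

theorem HasStieltjesMoments.eq_of_centralBinom_rpow {c : ℝ} (hc : 0 < c) {μ ν : Measure ℝ}
    (hμ : HasStieltjesMoments μ (fun n => (Nat.centralBinom n : ℝ) ^ c))
    (hν : HasStieltjesMoments ν (fun n => (Nat.centralBinom n : ℝ) ^ c)) : μ = ν :=
  measure_eq_of_moment_eq (fun n => (hμ.2 n).1) (fun n => (hν.2 n).1)
    (fun n => (hμ.2 n).2.trans_le (centralBinom_rpow_le hc n))
    fun n => (hμ.2 n).2.trans (hν.2 n).2.symm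

theorem theorem2 :
    -- (a) the central binomial sequence is infinitely divisible
    IsInfDivStieltjesMomentSeq (fun n => (Nat.centralBinom n : ℝ)) ∧
    -- (b) density and moment generating function
    (∀ (Ω : Type*) [MeasurableSpace Ω] (P : Measure Ω) [IsProbabilityMeasure P] (X : Ω → ℝ),
      AEMeasurable X P →
      (∀ n : ℕ, Integrable (fun ω => X ω ^ n) P ∧ ∫ ω, X ω ^ n ∂P = (Nat.centralBinom n : ℝ)) →
      P.map X = volume.withDensity (fun x => ENNReal.ofReal (arcsineDensity x)) ∧
      ∀ t : ℝ, Integrable (fun ω => Real.exp (t * X ω)) P ∧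
        HasSum (fun n : ℕ => (Nat.centralBinom n : ℝ) * (t ^ n / (n.factorial : ℝ))) (mgf X P t) ∧
        mgf X P t = Real.exp (2 * t) * besselI 0 (2 * t)) ∧
    -- (c) determinacy of all positive powers
    (∀ c : ℝ, 0 < c → IsStieltjesDet (fun n => (Nat.centralBinom n : ℝ) ^ c)) ∧
    -- (d) Mellin transforms
    (∀ c : ℝ, 0 < c → ∀ μ : Measure ℝ,
      HasStieltjesMoments μ (fun n => (Nat.centralBinom n : ℝ) ^ c) →
      ∀ s : ℝ, 0 ≤ s →
        Integrable (fun x : ℝ => x ^ s) μ ∧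
        ∫ x, x ^ s ∂μ =
          ((2 : ℝ) ^ (2 * s) / Real.sqrt Real.pi *
            (Real.Gamma (s + 1 / 2) / Real.Gamma (s + 1))) ^ c ∧
        ∫ x, x ^ s ∂μ = (Real.Gamma (2 * s + 1) / Real.Gamma (s + 1) ^ 2) ^ c) := by

  refine ⟨fun c hc => ?_, fun Ω _ P _ X hX hmom => ?_, fun c hc => ?_, fun c hc μ hμ s hs => ?_⟩
  · obtain ⟨μ, hμ, -⟩ := exists_hasStieltjesMoments_mellin hc
    exact ⟨μ, hμ⟩
  · have hlaw : ∀ n : ℕ, Integrable (fun x : ℝ => x ^ n) (P.map X) ∧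
        ∫ x, x ^ n ∂(P.map X) = Nat.centralBinom n := fun n =>
      ⟨(integrable_map_measure (by fun_prop) hX).2 (hmom n).1,
        (integral_map hX (by fun_prop)).trans (hmom n).2⟩
    have hle : ∀ n : ℕ, ∫ x, x ^ n ∂(P.map X) ≤ 4 ^ n := fun n =>
      (hlaw n).2.trans_le (centralBinom_le_four_pow n)
    -- X is not assumed nonnegative; determinacy holds among all measures on ℝ.
    refine ⟨measure_eq_of_moment_eq (fun n => (hlaw n).1) (fun n => (arcsine_moments n).1) hle
      fun n => (hlaw n).2.trans (arcsine_moments n).2.symm, fun t => ?_⟩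
    have hsum : HasSum (fun n : ℕ => (Nat.centralBinom n : ℝ) * (t ^ n / (n.factorial : ℝ)))
        (mgf X P t) := by
      have h := hasSum_mgf_of_moment_le (fun n => (hlaw n).1) hle t
      simp only [(hlaw _).2, mgf_id_map hX] at h
      simpa only [mul_comm] using h
    refine ⟨?_, hsum, hsum.unique (hasSum_centralBinom_mul_pow_div_factorial t)⟩
    exact (integrable_exp_mul_of_moment_le (fun n => (hlaw n).1) hle t).comp_aemeasurable hX
  · obtain ⟨μ, hμ, -⟩ := exists_hasStieltjesMoments_mellin hc
    exact ⟨μ, hμ, fun ν hν => hν.eq_of_centralBinom_rpow hc hμ⟩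
  · obtain ⟨ν, hν, h⟩ := exists_hasStieltjesMoments_mellin hc
    -- Integer moments alone identify μ with the constructed measure, whose Mellin transform is
    -- known for all real s ≥ 0.
    obtain rfl := hμ.eq_of_centralBinom_rpow hc hν
    exact ⟨(h s hs).1, (h s hs).2, by rw [(h s hs).2, gamma_ratio_eq hs]⟩
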